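/- Let $\mathcal C$ be a category with pullbacks and let $p:\mathcal E\to\mathcal C$ be a cloven bifibration, i.e. a functor with, for every $f:B\to A$ in $\mathcal C$, a chosen cartesian lift $\hat f_X:f^*X\to X$ of $f$ at every object $X$ of the fiber $\mathcal E_A$ and a chosen cocartesian lift $\tilde f_Y:Y\to f_!Y$ of $f$ at every object $Y$ of the fiber $\mathcal E_B$. These choices induce functors $f^*:\mathcal E_A\to\mathcal E_B$ and $f_!:\mathcal E_B\to\mathcal E_A$, canonical isomorphisms $\iota_B:\mathrm{Id}\Rightarrow(\mathrm{id}_B)^*$ and $\kappa_{f,g}:g^*f^*\Rightarrow(f\circ g)^*$, and an adjunction in which $f_!$ is left adjoint to $f^*$, with unit $\eta_f$ and counit $\varepsilon_f$. Suppose that $p$ satisfies the Beck–Chevalley condition: for every pullback square $d\circ a=e\circ c$ in $\mathcal C$ the transformation $$\mathsf{BC}=(\varepsilon_c\cdot e^*d_!)\circ(c_!\cdot(\kappa_{e,c}^{-1}\circ\kappa_{d,a})\cdot d_!)\circ(c_!a^*\cdot\eta_d):\ c_!a^*\Rightarrow e^*d_!$$ is an isomorphism. Let $f:B\to A$ be a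 morphism of $\mathcal C$, let $f_1,f_2:B\times_AB\to B$ be its kernel pair, let $\pi_1,\pi_2:(B\times_AB)\times_B(B\times_AB)\to B\times_AB$ be the pullback projections with $f_2\pi_2=f_1\pi_1$, and put $\Delta=\langle\mathrm{id}_B,\mathrm{id}_B\rangle:B\to B\times_AB$ and $\pi=\langle f_1\pi_2,f_2\pi_1\rangle$. Consider the canonical isomorphisms $d_i=\kappa_{f_i,\Delta}^{-1}\circ\iota_B:\mathrm{Id}\Rightarrow\Delta^*f_i^*$ and $j_i=\kappa_{f_i,\pi_{3-i}}^{-1}\circ\kappa_{f_i,\pi}:\pi^*f_i^*\Rightarrow\pi_{3-i}^*f_i^*$ ($i=1,2$), and $j=\kappa_{f_1,\pi_1}^{-1}\circ\kappa_{f_2,\pi_2}:\pi_2^*f_2^*\Rightarrow\pi_1^*f_1^*$. Define three categories. * $\mathsf{EM}_p(T_f)$ is the Eilenberg–Moore category of the monad $T_f=(f^*f_!,\eta_f,f^*\varepsilon_ff_!)$ on $\mathcal E_B$. * $\mathsf{Desc}_p(f)$ has as objects the pairs $(X,\varphi)$ of an object $X$ of $\mathcal E_B$ and an isomorphism $\varphi:f_1^*X\to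 f_2^*X$ in $\mathcal E_{B\times_AB}$ such that (DD1) $(d_2^{-1})_X\circ\Delta^*\varphi\circ(d_1)_X=\mathrm{id}_X$ and (DD2) $\pi_1^*\varphi\circ j_X\circ\pi_2^*\varphi=(j_2)_X\circ\pi^*\varphi\circ(j_1^{-1})_X$; a morphism $(X,\varphi)\to(Y,\psi)$ is an arrow $\theta:X\to Y$ of $\mathcal E_B$ with $f_2^*\theta\circ\varphi=\psi\circ f_1^*\theta$. * $\mathsf{Act}_p^{\mathsf{Eq}(f)}$ has as objects the pairs $(X,\beta)$ of an object $X$ of $\mathcal E_B$ and an arrow $\beta:(f_2)_!f_1^*X\to X$ of $\mathcal E_B$ such that (AC1) $\beta\circ\eta'_X=\mathrm{id}_X$ and (AC2) $\beta\circ\mu'_X=\beta\circ(f_2)_!f_1^*\beta$, where $\eta'=(d_2^{-1}\cdot(f_2)_!f_1^*)\circ(\Delta^*\cdot\eta_{f_2}\cdot f_1^*)\circ d_1$ and $\mu'=((f_2)_!\cdot\varepsilon_\pi\cdot f_1^*)\circ(k_2\cdot j_1^{-1})\circ((f_2)_!\cdot\mathsf{BC}^{-1}\cdot f_1^*)$;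 here $\mathsf{BC}:(\pi_1)_!\pi_2^*\Rightarrow f_1^*(f_2)_!$ is the Beck–Chevalley isomorphism of the pullback square $f_2\pi_2=f_1\pi_1$, and $k_2:(f_2)_!(\pi_1)_!\Rightarrow(f_2)_!\pi_!$ is the transformation of left adjoints corresponding (as its mate) to $j_2$; a morphism $(X,\beta)\to(X',\beta')$ is an arrow $h:X\to X'$ of $\mathcal E_B$ with $h\circ\beta=\beta'\circ(f_2)_!f_1^*h$. Then the three categories are equivalent, $$\mathsf{EM}_p(T_f)\simeq\mathsf{Desc}_p(f)\simeq\mathsf{Act}_p^{\mathsf{Eq}(f)}.$$ More precisely, there are equivalences $F:\mathsf{EM}_p(T_f)\to\mathsf{Desc}_p(f)$, $G:\mathsf{Desc}_p(f)\to\mathsf{Act}_p^{\mathsf{Eq}(f)}$ and $H:\mathsf{Act}_p^{\mathsf{Eq}(f)}\to\mathsf{EM}_p(T_f)$, commuting with the forgetful functors to $\mathcal E_B$, such that each of the composites $HGF$, $FHG$ and $GFH$ is the identity functor. -/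

import Mathlib

open CategoryTheory CategoryTheory.Limits

open CategoryTheory.Functor.Fiber (fiberInclusion)

-- Arrows `X ⟶ Y` of a category are then read through `CategoryStruct.toQuiver` only.
attribute [-instance] catToReflQuiver

universe v₁ u₁ v₂ u₂

/-- A cloven bifibration structure on a functor `p : E ⥤ C`: for every `f : B ⟶ A` in `C` a chosen
cartesian lift `f^* X ⟶ X` of `f` at every `X` in the fiber over `A` (a cleavage), and a chosen
cocartesian lift `Y ⟶ f_! Y` of `f` at every `Y` in the fiber over `B` (a cocleavage).
`IsStronglyCartesian` / `IsStronglyCocartesian` is Mathlib's name for the usual (co)cartesian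
arrows, whose universal property is about arrows over arbitrary composites in the base. -/
structure ClovenBifibration {C : Type u₁} [Category.{v₁} C] {E : Type u₂} [Category.{v₂} E]
    (p : E ⥤ C) where
  /-- The domain `f^* X` of the chosen cartesian lift of `f` at `X`. -/
  pullObj {A B : C} (f : B ⟶ A) (X : p.Fiber A) : p.Fiber B
  /-- The chosen cartesian lift `f^* X ⟶ X`. -/
  cart {A B : C} (f : B ⟶ A) (X : p.Fiber A) :
    fiberInclusion.obj (pullObj f X) ⟶ fiberInclusion.obj X
  cart_isStronglyCartesian {A B : C} (f : B ⟶ A) (X : p.Fiber A) :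
    p.IsStronglyCartesian f (cart f X)
  /-- The codomain `f_! Y` of the chosen cocartesian lift of `f` at `Y`. -/
  pushObj {A B : C} (f : B ⟶ A) (Y : p.Fiber B) : p.Fiber A
  /-- The chosen cocartesian lift `Y ⟶ f_! Y`. -/
  cocart {A B : C} (f : B ⟶ A) (Y : p.Fiber B) :
    fiberInclusion.obj Y ⟶ fiberInclusion.obj (pushObj f Y)
  cocart_isStronglyCocartesian {A B : C} (f : B ⟶ A) (Y : p.Fiber B) :
    p.IsStronglyCocartesian f (cocart f Y)

namespace ClovenBifibration

attribute [instance] cart_isStronglyCartesian cocart_isStronglyCocartesian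

noncomputable section

variable {C : Type u₁} [Category.{v₁} C] {E : Type u₂} [Category.{v₂} E] {p : E ⥤ C}

/-- An arrow of `E` over the identity of `A`, as an arrow of the fiber over `A`. -/
def homOf {A : C} {X Y : p.Fiber A} (t : fiberInclusion.obj X ⟶ fiberInclusion.obj Y)
    [h : p.IsHomLift (𝟙 A) t] : X ⟶ Y := ⟨t, h⟩

theorem map_homOf {A : C} {X Y : p.Fiber A} (t : fiberInclusion.obj X ⟶ fiberInclusion.obj Y)
    [p.IsHomLift (𝟙 A) t] : fiberInclusion.map (homOf t) = t := rfl

variable (b : ClovenBifibration p)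

section Basic

variable {A B : C} (f : B ⟶ A)

/-- The unique arrow `Z ⟶ f^* X` of the fiber over `B` through which an arrow `h : Z ⟶ X` over `f`
factors. -/
def pullLift {Z : p.Fiber B} {X : p.Fiber A} (h : fiberInclusion.obj Z ⟶ fiberInclusion.obj X)
    [p.IsHomLift f h] : Z ⟶ b.pullObj f X :=
  homOf (Functor.IsCartesian.map p f (b.cart f X) h)

theorem pullLift_fac {Z : p.Fiber B} {X : p.Fiber A}
    (h : fiberInclusion.obj Z ⟶ fiberInclusion.obj X) [p.IsHomLift f h] :
    fiberInclusion.map (b.pullLift f h) ≫ b.cart f X = h :=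
  Functor.IsCartesian.fac p f (b.cart f X) h

theorem pull_hom_ext {Z : p.Fiber B} {X : p.Fiber A} {s t : Z ⟶ b.pullObj f X}
    (h : fiberInclusion.map s ≫ b.cart f X = fiberInclusion.map t ≫ b.cart f X) : s = t :=
  Functor.Fiber.hom_ext (Functor.IsCartesian.ext p f (b.cart f X) _ _ h)

/-- The unique arrow `f_! Y ⟶ Z` of the fiber over `A` through which an arrow `h : Y ⟶ Z` over `f`
factors. -/
def pushDesc {Y : p.Fiber B} {Z : p.Fiber A} (h : fiberInclusion.obj Y ⟶ fiberInclusion.obj Z)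
    [p.IsHomLift f h] : b.pushObj f Y ⟶ Z :=
  homOf (Functor.IsCocartesian.map p f (b.cocart f Y) h)

theorem pushDesc_fac {Y : p.Fiber B} {Z : p.Fiber A}
    (h : fiberInclusion.obj Y ⟶ fiberInclusion.obj Z) [p.IsHomLift f h] :
    b.cocart f Y ≫ fiberInclusion.map (b.pushDesc f h) = h :=
  Functor.IsCocartesian.fac p f (b.cocart f Y) h

theorem push_hom_ext {Y : p.Fiber B} {Z : p.Fiber A} {s t : b.pushObj f Y ⟶ Z}
    (h : b.cocart f Y ≫ fiberInclusion.map s = b.cocart f Y ≫ fiberInclusion.map t) : s = t :=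
  Functor.Fiber.hom_ext (Functor.IsCocartesian.ext p f (b.cocart f Y) _ _ h)

/-- The action of `f^*` on arrows. -/
def pullMap {X Y : p.Fiber A} (t : X ⟶ Y) : b.pullObj f X ⟶ b.pullObj f Y :=
  b.pullLift f (b.cart f X ≫ fiberInclusion.map t)

theorem pullMap_fac {X Y : p.Fiber A} (t : X ⟶ Y) :
    fiberInclusion.map (b.pullMap f t) ≫ b.cart f Y = b.cart f X ≫ fiberInclusion.map t :=
  b.pullLift_fac f _

/-- The pullback functor `f^* : E_A ⥤ E_B`. -/
def pull : p.Fiber A ⥤ p.Fiber B where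
  obj X := b.pullObj f X
  map t := b.pullMap f t
  map_id X := b.pull_hom_ext f (by
    rw [pullMap_fac, CategoryTheory.Functor.map_id, CategoryTheory.Functor.map_id, Category.comp_id,
      Category.id_comp])
  map_comp s t := b.pull_hom_ext f (by
    rw [pullMap_fac, Functor.map_comp, Functor.map_comp, Category.assoc, pullMap_fac,
      reassoc_of% b.pullMap_fac f s])

/-- The action of `f_!` on arrows. -/
def pushMap {X Y : p.Fiber B} (t : X ⟶ Y) : b.pushObj f X ⟶ b.pushObj f Y :=
  b.pushDesc f (fiberInclusion.map t ≫ b.cocart f Y)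

theorem pushMap_fac {X Y : p.Fiber B} (t : X ⟶ Y) :
    b.cocart f X ≫ fiberInclusion.map (b.pushMap f t) = fiberInclusion.map t ≫ b.cocart f Y :=
  b.pushDesc_fac f _

/-- The direct image functor `f_! : E_B ⥤ E_A`. -/
def push : p.Fiber B ⥤ p.Fiber A where
  obj Y := b.pushObj f Y
  map t := b.pushMap f t
  map_id X := b.push_hom_ext f (by
    rw [pushMap_fac, CategoryTheory.Functor.map_id, CategoryTheory.Functor.map_id, Category.comp_id,
      Category.id_comp])
  map_comp s t := b.push_hom_ext f (by
    rw [pushMap_fac, Functor.map_comp, Functor.map_comp, reassoc_of% b.pushMap_fac f s,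
      pushMap_fac, Category.assoc])

/-- The component of the unit `η_f` at `X`: the factorization of the cocartesian lift `X ⟶ f_! X`
through the cartesian lift `f^* f_! X ⟶ f_! X`. -/
def unitApp (X : p.Fiber B) : X ⟶ b.pullObj f (b.pushObj f X) := b.pullLift f (b.cocart f X)

theorem unitApp_fac (X : p.Fiber B) :
    fiberInclusion.map (b.unitApp f X) ≫ b.cart f (b.pushObj f X) = b.cocart f X :=
  b.pullLift_fac f _

theorem unitApp_naturality {X Y : p.Fiber B} (t : X ⟶ Y) :
    t ≫ b.unitApp f Y = b.unitApp f X ≫ b.pullMap f (b.pushMap f t) :=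
  b.pull_hom_ext f (by
    rw [Functor.map_comp, Functor.map_comp, Category.assoc, Category.assoc, unitApp_fac,
      pullMap_fac, reassoc_of% b.unitApp_fac f X, pushMap_fac])

/-- The component of the counit `ε_f` at `Y`: the factorization of the cartesian lift `f^* Y ⟶ Y`
through the cocartesian lift `f^* Y ⟶ f_! f^* Y`. -/
def counitApp (Y : p.Fiber A) : b.pushObj f (b.pullObj f Y) ⟶ Y := b.pushDesc f (b.cart f Y)

theorem counitApp_fac (Y : p.Fiber A) :
    b.cocart f (b.pullObj f Y) ≫ fiberInclusion.map (b.counitApp f Y) = b.cart f Y :=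
  b.pushDesc_fac f _

theorem counitApp_naturality {X Y : p.Fiber A} (t : X ⟶ Y) :
    b.pushMap f (b.pullMap f t) ≫ b.counitApp f Y = b.counitApp f X ≫ t :=
  b.push_hom_ext f (by
    rw [Functor.map_comp, Functor.map_comp, reassoc_of% b.pushMap_fac f (b.pullMap f t),
      counitApp_fac, pullMap_fac, reassoc_of% b.counitApp_fac f X])

theorem left_triangle (Y : p.Fiber B) :
    b.pushMap f (b.unitApp f Y) ≫ b.counitApp f (b.pushObj f Y) = 𝟙 (b.pushObj f Y) :=
  b.push_hom_ext f (by
    rw [Functor.map_comp, reassoc_of% b.pushMap_fac f (b.unitApp f Y), counitApp_fac, unitApp_fac,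
      CategoryTheory.Functor.map_id, Category.comp_id])

theorem right_triangle (X : p.Fiber A) :
    b.unitApp f (b.pullObj f X) ≫ b.pullMap f (b.counitApp f X) = 𝟙 (b.pullObj f X) :=
  b.pull_hom_ext f (by
    rw [Functor.map_comp, Category.assoc, pullMap_fac, reassoc_of% b.unitApp_fac f (b.pullObj f X),
      counitApp_fac, CategoryTheory.Functor.map_id, Category.id_comp])

/-- The adjunction `f_! ⊣ f^*` with unit `η_f` and counit `ε_f`. -/
def adj : b.push f ⊣ b.pull f where
  unit :=
    { app := fun X => b.unitApp f X
      naturality := fun _ _ t => b.unitApp_naturality f t }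
  counit :=
    { app := fun Y => b.counitApp f Y
      naturality := fun _ _ t => b.counitApp_naturality f t }
  left_triangle_components Y := b.left_triangle f Y
  right_triangle_components X := b.right_triangle f X

end Basic

theorem id_isHomLift {B : C} (X : p.Fiber B) : p.IsHomLift (𝟙 B) (𝟙 (fiberInclusion.obj X)) :=
  IsHomLift.id X.2

/-- The component at `X` of the canonical isomorphism `ι_B : Id ≅ (id_B)^*`: the factorization of
`id_X` through the cartesian lift `(id_B)^* X ⟶ X`. -/
def iotaApp {B : C} (X : p.Fiber B) : X ≅ b.pullObj (𝟙 B) X where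
  hom := haveI := id_isHomLift X; b.pullLift (𝟙 B) (𝟙 (fiberInclusion.obj X))
  inv := homOf (b.cart (𝟙 B) X)
  hom_inv_id := Functor.Fiber.hom_ext (by
    rw [Functor.map_comp, map_homOf, pullLift_fac, CategoryTheory.Functor.map_id])
  inv_hom_id := b.pull_hom_ext (𝟙 B) (by
    rw [Functor.map_comp, Category.assoc, map_homOf, pullLift_fac, CategoryTheory.Functor.map_id,
      Category.comp_id, Category.id_comp])

theorem iotaApp_fac {B : C} (X : p.Fiber B) :
    fiberInclusion.map (b.iotaApp X).hom ≫ b.cart (𝟙 B) X = 𝟙 (fiberInclusion.obj X) :=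
  haveI := id_isHomLift X
  b.pullLift_fac (𝟙 B) _

theorem iotaApp_naturality {B : C} {X Y : p.Fiber B} (t : X ⟶ Y) :
    t ≫ (b.iotaApp Y).hom = (b.iotaApp X).hom ≫ b.pullMap (𝟙 B) t :=
  b.pull_hom_ext (𝟙 B) (by
    rw [Functor.map_comp, Functor.map_comp, Category.assoc, Category.assoc, iotaApp_fac,
      pullMap_fac, reassoc_of% b.iotaApp_fac X, Category.comp_id])

/-- The canonical isomorphism `ι_B : Id ≅ (id_B)^*`. -/
def iota (B : C) : 𝟭 (p.Fiber B) ≅ b.pull (𝟙 B) :=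
  NatIso.ofComponents (fun X => b.iotaApp X) (fun t => b.iotaApp_naturality t)

section Kappa

variable {A B D : C} (f : B ⟶ A) (g : D ⟶ B) (h : D ⟶ A)

/-- The composite `g^* f^* Y ⟶ f^* Y ⟶ Y` of chosen cartesian lifts. -/
def cartComp (Y : p.Fiber A) :
    fiberInclusion.obj (b.pullObj g (b.pullObj f Y)) ⟶ fiberInclusion.obj Y :=
  b.cart g (b.pullObj f Y) ≫ b.cart f Y

theorem cartComp_isStronglyCartesian (w : g ≫ f = h) (Y : p.Fiber A) :
    p.IsStronglyCartesian h (b.cartComp f g Y) := by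
  subst w
  exact Functor.IsStronglyCartesian.comp p

/-- The component at `Y` of the canonical isomorphism `κ_{f,g} : g^* f^* ≅ (f ∘ g)^*`: the
factorization of `g^* f^* Y ⟶ f^* Y ⟶ Y` through the cartesian lift `(f ∘ g)^* Y ⟶ Y`. -/
def kappaApp (w : g ≫ f = h) (Y : p.Fiber A) :
    b.pullObj g (b.pullObj f Y) ≅ b.pullObj h Y :=
  haveI := b.cartComp_isStronglyCartesian f g h w Y
  { hom := b.pullLift h (b.cartComp f g Y)
    inv := homOf (Functor.IsCartesian.map p h (b.cartComp f g Y) (b.cart h Y))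
    hom_inv_id := Functor.Fiber.hom_ext (Functor.IsCartesian.ext p h (b.cartComp f g Y) _ _ (by
      rw [Functor.map_comp, Category.assoc, map_homOf, Functor.IsCartesian.fac, pullLift_fac,
        CategoryTheory.Functor.map_id, Category.id_comp]))
    inv_hom_id := b.pull_hom_ext h (by
      rw [Functor.map_comp, Category.assoc, map_homOf, pullLift_fac, Functor.IsCartesian.fac,
        CategoryTheory.Functor.map_id, Category.id_comp]) }

theorem kappaApp_fac (w : g ≫ f = h) (Y : p.Fiber A) :
    fiberInclusion.map (b.kappaApp f g h w Y).hom ≫ b.cart h Y =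
      b.cart g (b.pullObj f Y) ≫ b.cart f Y :=
  haveI := b.cartComp_isStronglyCartesian f g h w Y
  b.pullLift_fac h (b.cartComp f g Y)

theorem kappaApp_naturality (w : g ≫ f = h) {X Y : p.Fiber A} (t : X ⟶ Y) :
    b.pullMap g (b.pullMap f t) ≫ (b.kappaApp f g h w Y).hom =
      (b.kappaApp f g h w X).hom ≫ b.pullMap h t :=
  b.pull_hom_ext h (by
    rw [Functor.map_comp, Functor.map_comp, Category.assoc, Category.assoc, kappaApp_fac,
      pullMap_fac, reassoc_of% b.kappaApp_fac f g h w X,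
      reassoc_of% b.pullMap_fac g (b.pullMap f t), pullMap_fac])

/-- The canonical isomorphism `κ_{f,g} : g^* f^* ≅ (f ∘ g)^*`. The composite `f ∘ g` is allowed to
be given as any `h` with a proof of `g ≫ f = h`. -/
def kappa (w : g ≫ f = h) : b.pull f ⋙ b.pull g ≅ b.pull h :=
  NatIso.ofComponents (fun Y => b.kappaApp f g h w Y) (fun t => b.kappaApp_naturality f g h w t)

end Kappa

/-- The canonical isomorphism `χ = κ_{h,k}⁻¹ ∘ κ_{f,g} : g^* f^* ≅ k^* h^*` of a commutative square
`f ∘ g = h ∘ k`. -/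
def chi {A B B' D : C} {f : B ⟶ A} {g : D ⟶ B} {h : B' ⟶ A} {k : D ⟶ B'} (w : g ≫ f = k ≫ h) :
    b.pull f ⋙ b.pull g ≅ b.pull h ⋙ b.pull k :=
  b.kappa f g (k ≫ h) w ≪≫ (b.kappa h k (k ≫ h) rfl).symm

/-- The Beck-Chevalley transformation `c_! a^* ⟶ e^* d_!` of a commutative square
`d ∘ a = e ∘ c`: the composite of `c_! a^* η_d`, `c_! χ d_!` and `ε_c e^* d_!`. -/
def beckChevalley {P B Q D : C} {a : P ⟶ B} {c : P ⟶ Q} {d : B ⟶ D} {e : Q ⟶ D}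
    (w : a ≫ d = c ≫ e) : b.pull a ⋙ b.push c ⟶ b.push d ⋙ b.pull e where
  app X := (b.push c).map ((b.pull a).map ((b.adj d).unit.app X)) ≫
    (b.push c).map ((b.chi w).hom.app ((b.push d).obj X)) ≫
    (b.adj c).counit.app ((b.pull e).obj ((b.push d).obj X))
  naturality X Y t := by
    have h₁ := congrArg (fun s => (b.push c).map ((b.pull a).map s)) ((b.adj d).unit.naturality t)
    have h₂ := congrArg (b.push c).map ((b.chi w).hom.naturality ((b.push d).map t))
    have h₃ := (b.adj c).counit.naturality ((b.pull e).map ((b.push d).map t))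
    simp only [Functor.map_comp, Functor.comp_map, Functor.id_map] at h₁ h₂ h₃ ⊢
    simp only [Category.assoc]
    erw [reassoc_of% h₁, reassoc_of% h₂, h₃]

/-- The Beck-Chevalley property: the Beck-Chevalley transformation of every pullback square of `C`
is an isomorphism. -/
def BeckChevalley : Prop :=
  ∀ ⦃P B Q D : C⦄ ⦃a : P ⟶ B⦄ ⦃c : P ⟶ Q⦄ ⦃d : B ⟶ D⦄ ⦃e : Q ⟶ D⦄ (h : IsPullback a c d e),
    IsIso (b.beckChevalley h.w)

/-- The monad `T_f = f^* f_!` on `E_B`, with unit `η_f` and multiplication `f^* ε_f f_!`. -/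
def T {A B : C} (f : B ⟶ A) : Monad (p.Fiber B) := (b.adj f).toMonad

/-- The Eilenberg-Moore category of `T_f`. -/
abbrev EM {A B : C} (f : B ⟶ A) := (b.T f).Algebra

section Descent

variable [HasPullbacks C] {A B : C} (f : B ⟶ A)

/-- `B ×_A B`. -/
abbrev ker : C := pullback f f

/-- The first projection of the kernel pair of `f`. -/
abbrev f₁ : ker f ⟶ B := pullback.fst f f

/-- The second projection of the kernel pair of `f`. -/
abbrev f₂ : ker f ⟶ B := pullback.snd f f

/-- `(B ×_A B) ×_B (B ×_A B)`, the pullback of `f₂` and `f₁`, so that `f₂ ∘ π₂ = f₁ ∘ π₁`. -/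
abbrev ker₂ : C := pullback (f₂ f) (f₁ f)

/-- The projection `π₁`, with `f₁ ∘ π₁ = f₂ ∘ π₂`. -/
abbrev π₁ : ker₂ f ⟶ ker f := pullback.snd (f₂ f) (f₁ f)

/-- The projection `π₂`, with `f₂ ∘ π₂ = f₁ ∘ π₁`. -/
abbrev π₂ : ker₂ f ⟶ ker f := pullback.fst (f₂ f) (f₁ f)

/-- The identity-assigning morphism `Δ = ⟨id, id⟩` of the internal category `Eq(f)`. -/
def diag : B ⟶ ker f := pullback.lift (𝟙 B) (𝟙 B) rfl

/-- The composition morphism `π = ⟨f₁ π₂, f₂ π₁⟩` of the internal category `Eq(f)`. -/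
def π : ker₂ f ⟶ ker f :=
  pullback.lift (π₂ f ≫ f₁ f) (π₁ f ≫ f₂ f) (by
    rw [Category.assoc, Category.assoc, pullback.condition (f := f) (g := f),
      pullback.condition_assoc (f := f₂ f) (g := f₁ f), pullback.condition (f := f) (g := f)])

theorem diag_f₁ : diag f ≫ f₁ f = 𝟙 B := pullback.lift_fst _ _ _

theorem diag_f₂ : diag f ≫ f₂ f = 𝟙 B := pullback.lift_snd _ _ _

theorem π_f₁ : π f ≫ f₁ f = π₂ f ≫ f₁ f := pullback.lift_fst _ _ _

theorem π_f₂ : π f ≫ f₂ f = π₁ f ≫ f₂ f := pullback.lift_snd _ _ _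

theorem π₂_f₂ : π₂ f ≫ f₂ f = π₁ f ≫ f₁ f := pullback.condition

/-- `d₁ : Id ≅ Δ^* f₁^*`. -/
def d₁ : 𝟭 (p.Fiber B) ≅ b.pull (f₁ f) ⋙ b.pull (diag f) :=
  b.iota B ≪≫ (b.kappa (f₁ f) (diag f) (𝟙 B) (diag_f₁ f)).symm

/-- `d₂ : Id ≅ Δ^* f₂^*`. -/
def d₂ : 𝟭 (p.Fiber B) ≅ b.pull (f₂ f) ⋙ b.pull (diag f) :=
  b.iota B ≪≫ (b.kappa (f₂ f) (diag f) (𝟙 B) (diag_f₂ f)).symm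

/-- `j₁ : π^* f₁^* ≅ π₂^* f₁^*`. -/
def j₁ : b.pull (f₁ f) ⋙ b.pull (π f) ≅ b.pull (f₁ f) ⋙ b.pull (π₂ f) := b.chi (π_f₁ f)

/-- `j₂ : π^* f₂^* ≅ π₁^* f₂^*`. -/
def j₂ : b.pull (f₂ f) ⋙ b.pull (π f) ≅ b.pull (f₂ f) ⋙ b.pull (π₁ f) := b.chi (π_f₂ f)

/-- `j : π₂^* f₂^* ≅ π₁^* f₁^*`. -/
def j : b.pull (f₂ f) ⋙ b.pull (π₂ f) ≅ b.pull (f₁ f) ⋙ b.pull (π₁ f) := b.chi (π₂_f₂ f)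

/-- An object of `Desc_p(f)`: an object `X` of `E_B` with a descent datum
`φ : f₁^* X ⟶ f₂^* X`. -/
structure Desc where
  /-- The underlying object. -/
  X : p.Fiber B
  /-- The descent datum. -/
  φ : (b.pull (f₁ f)).obj X ⟶ (b.pull (f₂ f)).obj X
  isIso : IsIso φ
  dd1 : (b.d₁ f).hom.app X ≫ (b.pull (diag f)).map φ ≫ (b.d₂ f).inv.app X = 𝟙 X
  dd2 : (b.pull (π₂ f)).map φ ≫ (b.j f).hom.app X ≫ (b.pull (π₁ f)).map φ =
    (b.j₁ f).inv.app X ≫ (b.pull (π f)).map φ ≫ (b.j₂ f).hom.app X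

/-- A morphism of descent data. -/
@[ext]
structure Desc.Hom {b : ClovenBifibration p} {f : B ⟶ A} (M N : b.Desc f) where
  /-- The underlying arrow of `E_B`. -/
  θ : M.X ⟶ N.X
  comm : M.φ ≫ (b.pull (f₂ f)).map θ = (b.pull (f₁ f)).map θ ≫ N.φ

/-- The category `Desc_p(f)`. -/
instance : Category (b.Desc f) where
  Hom M N := Desc.Hom M N
  id M := ⟨𝟙 M.X, by simp⟩
  comp s t := ⟨s.θ ≫ t.θ, by
    rw [Functor.map_comp, Functor.map_comp, ← Category.assoc, s.comm, Category.assoc, t.comm,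
      Category.assoc]⟩
  id_comp s := Desc.Hom.ext (Category.id_comp s.θ)
  comp_id s := Desc.Hom.ext (Category.comp_id s.θ)
  assoc s t r := Desc.Hom.ext (Category.assoc s.θ t.θ r.θ)

/-- The forgetful functor `Desc_p(f) ⥤ E_B`. -/
def Desc.forget : b.Desc f ⥤ p.Fiber B where
  obj M := M.X
  map s := s.θ
  map_id _ := rfl
  map_comp _ _ := rfl

/-- `k₂ : (f₂)_! (π₁)_! ⟶ (f₂)_! π_!`, the two-fold mate of `j₂`, i.e. the transformation between
the composite left adjoints corresponding to `j₂ : π^* f₂^* ⟶ π₁^* f₂^*`. -/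
def k₂ : b.push (π₁ f) ⋙ b.push (f₂ f) ⟶ b.push (π f) ⋙ b.push (f₂ f) :=
  (conjugateEquiv ((b.adj (π f)).comp (b.adj (f₂ f)))
    ((b.adj (π₁ f)).comp (b.adj (f₂ f)))).symm (b.j₂ f).hom

/-- The inverse of the Beck-Chevalley transformation of the pullback square `f₂ ∘ π₂ = f₁ ∘ π₁`. -/
def bcInv {b : ClovenBifibration p} (h : b.BeckChevalley) (f : B ⟶ A) :
    b.push (f₂ f) ⋙ b.pull (f₁ f) ⟶ b.pull (π₂ f) ⋙ b.push (π₁ f) :=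
  haveI := h (IsPullback.of_hasPullback (f₂ f) (f₁ f))
  inv (b.beckChevalley (IsPullback.of_hasPullback (f₂ f) (f₁ f)).w)

/-- The component at `X` of `η' : Id ⟶ (f₂)_! f₁^*`, the composite
`d₂⁻¹ (f₂)_! f₁^* ∘ Δ^* η_{f₂} f₁^* ∘ d₁`. -/
def eta' (X : p.Fiber B) : X ⟶ (b.push (f₂ f)).obj ((b.pull (f₁ f)).obj X) :=
  (b.d₁ f).hom.app X ≫
    (b.pull (diag f)).map ((b.adj (f₂ f)).unit.app ((b.pull (f₁ f)).obj X)) ≫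
    (b.d₂ f).inv.app ((b.push (f₂ f)).obj ((b.pull (f₁ f)).obj X))

/-- The component at `X` of `μ' : (f₂)_! f₁^* (f₂)_! f₁^* ⟶ (f₂)_! f₁^*`, the composite
`(f₂)_! ε_π f₁^* ∘ (k₂ · j₁⁻¹) ∘ (f₂)_! BC⁻¹ f₁^*`. -/
def mu' {b : ClovenBifibration p} (h : b.BeckChevalley) (f : B ⟶ A) (X : p.Fiber B) :
    (b.push (f₂ f)).obj ((b.pull (f₁ f)).obj ((b.push (f₂ f)).obj ((b.pull (f₁ f)).obj X))) ⟶
      (b.push (f₂ f)).obj ((b.pull (f₁ f)).obj X) :=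
  (b.push (f₂ f)).map ((bcInv h f).app ((b.pull (f₁ f)).obj X)) ≫
    (b.push (f₂ f)).map ((b.push (π₁ f)).map ((b.j₁ f).inv.app X)) ≫
    (b.k₂ f).app ((b.pull (π f)).obj ((b.pull (f₁ f)).obj X)) ≫
    (b.push (f₂ f)).map ((b.adj (π f)).counit.app ((b.pull (f₁ f)).obj X))

/-- An action `(X, β)` of the internal category `Eq(f)` on `p`. -/
structure Act {b : ClovenBifibration p} (h : b.BeckChevalley) (f : B ⟶ A) where
  /-- The underlying object. -/
  X : p.Fiber B
  /-- The action. -/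
  β : (b.push (f₂ f)).obj ((b.pull (f₁ f)).obj X) ⟶ X
  ac1 : b.eta' f X ≫ β = 𝟙 X
  ac2 : mu' h f X ≫ β = (b.push (f₂ f)).map ((b.pull (f₁ f)).map β) ≫ β

/-- A morphism of actions. -/
@[ext]
structure Act.Hom {b : ClovenBifibration p} {h : b.BeckChevalley} {f : B ⟶ A}
    (M N : Act h f) where
  /-- The underlying arrow of `E_B`. -/
  θ : M.X ⟶ N.X
  comm : M.β ≫ θ = (b.push (f₂ f)).map ((b.pull (f₁ f)).map θ) ≫ N.β

variable {b} (h : b.BeckChevalley)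

/-- The category of actions of `Eq(f)` on `p`. -/
instance : Category (Act h f) where
  Hom M N := Act.Hom M N
  id M := ⟨𝟙 M.X, by simp⟩
  comp s t := ⟨s.θ ≫ t.θ, by
    rw [Functor.map_comp, Functor.map_comp, ← Category.assoc, s.comm, Category.assoc, t.comm,
      Category.assoc]⟩
  id_comp s := Act.Hom.ext (Category.id_comp s.θ)
  comp_id s := Act.Hom.ext (Category.comp_id s.θ)
  assoc s t r := Act.Hom.ext (Category.assoc s.θ t.θ r.θ)

/-- The forgetful functor from actions of `Eq(f)` to `E_B`. -/
def Act.forget : Act h f ⥤ p.Fiber B where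
  obj M := M.X
  map s := s.θ
  map_id _ := rfl
  map_comp _ _ := rfl

end Descent

end

end ClovenBifibration

/-! ### Factoring arrows of the total category through chosen lifts -/

namespace ClovenBifibration

noncomputable section

variable {C : Type u₁} [Category.{v₁} C] {E : Type u₂} [Category.{v₂} E] {p : E ⥤ C}
  (b : ClovenBifibration p)

/-! All three structures on `X` encode one thing: an arrow `u : f₁^* X ⟶ X` of the total category
lying over `f₂`. The cartesian lift of `f₂` turns `u` into `φ : f₁^* X ⟶ f₂^* X`, its cocartesian
lift turns `u` into `β : (f₂)_! f₁^* X ⟶ X`, and `β` becomes `α : f^* f_! X ⟶ X` along the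
Beck-Chevalley isomorphism of the kernel pair.

Composed with enough chosen lifts, the isomorphisms `ι` and `κ`, the units, counits and mates all
cancel, and each pair of axioms becomes `IsAction`: `u` restricts to the identity along the
diagonal, and acting twice agrees with first composing in `Eq(f)`. This is the content of `dd1_iff`,
`dd2_iff`, `ac1_iff`, `ac2_iff`, `alg_unit_iff` and `alg_assoc_iff`. No information is lost, because
arrows into a cartesian lift or out of a cocartesian one can be tested on the lift. For (AC2) and
for associativity of algebras one must also cancel `bcArrow`, which is possible by `bcArrow_ext`.
Invertibility of `φ` comes for free, since `Eq(f)` is a groupoid (`IsAction.isIso`).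

In all three categories a morphism is an arrow of the fiber intertwining the arrows `u`. The
passages preserve `X`, `u` and the morphisms strictly, and `u` determines the structure, so the
cyclic composites are equal to identity functors. -/

theorem fiber_hom_ext_iff {A : C} {X Y : p.Fiber A} {s t : X ⟶ Y} :
    s = t ↔ fiberInclusion.map s = fiberInclusion.map t :=
  ⟨fun h => h ▸ rfl, Functor.Fiber.hom_ext⟩

/-- Arrows into `f^* X` over a common arrow `g` are determined by their composite with the cartesian
lift. -/
theorem cart_ext {A B D : C} (f : B ⟶ A) (g : D ⟶ B) {X : p.Fiber A} {Z : E}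
    {s t : Z ⟶ fiberInclusion.obj (b.pullObj f X)} (hs : p.IsHomLift g s) (ht : p.IsHomLift g t)
    (h : s ≫ b.cart f X = t ≫ b.cart f X) : s = t :=
  Functor.IsStronglyCartesian.ext p f (b.cart f X) g h

/-- Arrows out of `f_! X` over a common arrow `g` are determined by their composite with the
cocartesian lift. -/
theorem cocart_ext {A B D : C} (f : B ⟶ A) (g : A ⟶ D) {X : p.Fiber B} {Z : E}
    {s t : fiberInclusion.obj (b.pushObj f X) ⟶ Z} (hs : p.IsHomLift g s) (ht : p.IsHomLift g t)
    (h : b.cocart f X ≫ s = b.cocart f X ≫ t) : s = t :=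
  Functor.IsStronglyCocartesian.ext p f (b.cocart f X) g h

/-- The relations between the morphisms of the kernel pair are only propositional equalities, so
lifts have to be moved along them before a universal property applies. -/
theorem isHomLift_of_eq {A B : C} {f g : B ⟶ A} {X Y : E} {s : X ⟶ Y} (hs : p.IsHomLift f s)
    (h : f = g) : p.IsHomLift g s := h ▸ hs

/-- The factorization over `g` of an arrow `t` over `g ≫ f` through the cartesian lift of `f`. -/
def cartLift {A B D : C} (f : B ⟶ A) (g : D ⟶ B) {X : p.Fiber A} {Z : E}
    (t : Z ⟶ fiberInclusion.obj X) (ht : p.IsHomLift (g ≫ f) t) :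
    Z ⟶ fiberInclusion.obj (b.pullObj f X) :=
  Functor.IsStronglyCartesian.map p f (b.cart f X) (g := g) rfl t

instance cartLift_isHomLift {A B D : C} (f : B ⟶ A) (g : D ⟶ B) {X : p.Fiber A} {Z : E}
    (t : Z ⟶ fiberInclusion.obj X) (ht : p.IsHomLift (g ≫ f) t) :
    p.IsHomLift g (b.cartLift f g t ht) :=
  Functor.IsStronglyCartesian.map_isHomLift p f (b.cart f X) rfl t

theorem cartLift_fac {A B D : C} (f : B ⟶ A) (g : D ⟶ B) {X : p.Fiber A} {Z : E}
    (t : Z ⟶ fiberInclusion.obj X) (ht : p.IsHomLift (g ≫ f) t) :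
    b.cartLift f g t ht ≫ b.cart f X = t :=
  Functor.IsStronglyCartesian.fac p f (b.cart f X) rfl t

/-! ### Comparison isomorphisms of commutative squares -/

section Chi

variable {A B B' D : C} {f : B ⟶ A} {g : D ⟶ B} {h : B' ⟶ A} {k : D ⟶ B'} (w : g ≫ f = k ≫ h)
  (X : p.Fiber A)

theorem kappaApp_inv_fac {A B D : C} (f : B ⟶ A) (g : D ⟶ B) (h : D ⟶ A) (w : g ≫ f = h)
    (Y : p.Fiber A) :
    fiberInclusion.map (b.kappaApp f g h w Y).inv ≫ b.cart g (b.pullObj f Y) ≫ b.cart f Y =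
      b.cart h Y := by
  rw [← kappaApp_fac b f g h w, ← Functor.map_comp_assoc, Iso.inv_hom_id,
    CategoryTheory.Functor.map_id, Category.id_comp]

/-- The component of `chi`. -/
def chiApp : b.pullObj g (b.pullObj f X) ≅ b.pullObj k (b.pullObj h X) :=
  b.kappaApp f g (k ≫ h) w X ≪≫ (b.kappaApp h k (k ≫ h) rfl X).symm

/-- Composites of cartesian lifts are cartesian, so this identity characterizes the comparison
isomorphism. It and its inverse form replace all later computation with `κ`. -/
theorem chiApp_hom_fac :
    fiberInclusion.map (b.chiApp w X).hom ≫ b.cart k (b.pullObj h X) ≫ b.cart h X =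
      b.cart g (b.pullObj f X) ≫ b.cart f X := by
  rw [chiApp, Iso.trans_hom, Functor.map_comp, Category.assoc, Iso.symm_hom, kappaApp_inv_fac,
    kappaApp_fac]

theorem chiApp_inv_fac :
    fiberInclusion.map (b.chiApp w X).inv ≫ b.cart g (b.pullObj f X) ≫ b.cart f X =
      b.cart k (b.pullObj h X) ≫ b.cart h X := by
  rw [← chiApp_hom_fac b w, ← Functor.map_comp_assoc, Iso.inv_hom_id,
    CategoryTheory.Functor.map_id, Category.id_comp]

end Chi

/-! ### The Beck-Chevalley transformation as an arrow of the total category -/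

section BC

variable {P B Q D : C} {a : P ⟶ B} {c : P ⟶ Q} {d : B ⟶ D} {e : Q ⟶ D}

/-- The component of the Beck-Chevalley transformation. -/
def bcApp (w : a ≫ d = c ≫ e) (X : p.Fiber B) :
    b.pushObj c (b.pullObj a X) ⟶ b.pullObj e (b.pushObj d X) :=
  (b.beckChevalley w).app X

/-- The arrow `a^* X ⟶ e^* d_! X` over `c` corresponding to the Beck-Chevalley transformation. -/
def bcArrow (w : a ≫ d = c ≫ e) (X : p.Fiber B) :
    fiberInclusion.obj (b.pullObj a X) ⟶ fiberInclusion.obj (b.pullObj e (b.pushObj d X)) :=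
  b.cocart c (b.pullObj a X) ≫ fiberInclusion.map (b.bcApp w X)

instance bcArrow_isHomLift (w : a ≫ d = c ≫ e) (X : p.Fiber B) :
    p.IsHomLift c (b.bcArrow w X) := by
  unfold bcArrow; infer_instance

/-- The lifts absorb the counit of `c`, the comparison and the unit of `d` in turn. As the lift of
`e` is cartesian, the identity determines `bcArrow` among arrows over `c`. -/
theorem bcArrow_fac (w : a ≫ d = c ≫ e) (X : p.Fiber B) :
    b.bcArrow w X ≫ b.cart e (b.pushObj d X) = b.cart a X ≫ b.cocart d X := by
  have : b.bcApp w X = b.pushMap c (b.pullMap a (b.unitApp d X)) ≫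
    b.pushMap c (b.chiApp w (b.pushObj d X)).hom ≫
    b.counitApp c (b.pullObj e (b.pushObj d X)) := rfl
  rw [bcArrow, this, Functor.map_comp, Functor.map_comp]
  simp only [Category.assoc]
  rw [reassoc_of% b.pushMap_fac, reassoc_of% b.pushMap_fac, reassoc_of% b.counitApp_fac,
    chiApp_hom_fac, reassoc_of% b.pullMap_fac, unitApp_fac]

theorem bcArrow_naturality (w : a ≫ d = c ≫ e) {X Y : p.Fiber B} (t : X ⟶ Y) :
    fiberInclusion.map (b.pullMap a t) ≫ b.bcArrow w Y =
      b.bcArrow w X ≫ fiberInclusion.map (b.pullMap e (b.pushMap d t)) := by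
  refine b.cart_ext e c inferInstance inferInstance ?_
  simp only [Category.assoc, bcArrow_fac, pullMap_fac, reassoc_of% b.pullMap_fac,
    reassoc_of% b.bcArrow_fac, pushMap_fac]

variable {b}

theorem bcApp_isIso (h : b.BeckChevalley) (sq : IsPullback a c d e) (X : p.Fiber B) :
    IsIso (b.bcApp sq.w X) :=
  haveI := h sq
  inferInstanceAs (IsIso ((b.beckChevalley sq.w).app X))

/-- Under the Beck-Chevalley condition, arrows out of `e^* d_! X` are determined by their composite
with `bcArrow`. -/
theorem bcArrow_ext (h : b.BeckChevalley) (sq : IsPullback a c d e) {X : p.Fiber B} {R : C}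
    (g : Q ⟶ R) {Z : E} {s t : fiberInclusion.obj (b.pullObj e (b.pushObj d X)) ⟶ Z}
    (hs : p.IsHomLift g s) (ht : p.IsHomLift g t)
    (hst : b.bcArrow sq.w X ≫ s = b.bcArrow sq.w X ≫ t) : s = t := by
  have := bcApp_isIso h sq X
  rw [← cancel_epi (fiberInclusion.map (b.bcApp sq.w X))]
  refine b.cocart_ext c g inferInstance inferInstance ?_
  simpa only [bcArrow, Category.assoc] using hst

end BC

end

/-! ### Unital and associative arrows over `f₂` -/

noncomputable section

variable {C : Type u₁} [Category.{v₁} C] [HasPullbacks C] {E : Type u₂} [Category.{v₂} E]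
  {p : E ⥤ C} (b : ClovenBifibration p) {A B : C} (f : B ⟶ A)

/-- The component of `d₁`. -/
def d₁App (X : p.Fiber B) : X ≅ b.pullObj (diag f) (b.pullObj (f₁ f) X) :=
  b.iotaApp X ≪≫ (b.kappaApp (f₁ f) (diag f) (𝟙 B) (diag_f₁ f) X).symm

/-- The component of `d₂`. -/
def d₂App (X : p.Fiber B) : X ≅ b.pullObj (diag f) (b.pullObj (f₂ f) X) :=
  b.iotaApp X ≪≫ (b.kappaApp (f₂ f) (diag f) (𝟙 B) (diag_f₂ f) X).symm

/-- The arrow `X ⟶ f₁^* X` over the diagonal which is a section of the cartesian lift. -/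
def diagLift (X : p.Fiber B) :
    fiberInclusion.obj X ⟶ fiberInclusion.obj (b.pullObj (f₁ f) X) :=
  fiberInclusion.map (b.d₁App f X).hom ≫ b.cart (diag f) (b.pullObj (f₁ f) X)

instance diagLift_isHomLift (X : p.Fiber B) : p.IsHomLift (diag f) (b.diagLift f X) := by
  unfold diagLift; infer_instance

theorem diagLift_fac (X : p.Fiber B) :
    b.diagLift f X ≫ b.cart (f₁ f) X = 𝟙 (fiberInclusion.obj X) := by
  rw [diagLift, d₁App, Iso.trans_hom, Iso.symm_hom, Functor.map_comp, Category.assoc,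
    Category.assoc, kappaApp_inv_fac, iotaApp_fac]

/-- The inverse of `iotaApp` is the cartesian lift of the identity itself, so this is `kappaApp_fac`
up to unfolding. -/
theorem d₂App_inv (X : p.Fiber B) :
    fiberInclusion.map (b.d₂App f X).inv =
      b.cart (diag f) (b.pullObj (f₂ f) X) ≫ b.cart (f₂ f) X :=
  b.kappaApp_fac (f₂ f) (diag f) (𝟙 B) (diag_f₂ f) X

/-- The arrow `π₂^* f₁^* X ⟶ f₁^* X` over the composition morphism `π`, compatible with the
cartesian lifts. -/
def compLift (X : p.Fiber B) :
    fiberInclusion.obj (b.pullObj (π₂ f) (b.pullObj (f₁ f) X)) ⟶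
      fiberInclusion.obj (b.pullObj (f₁ f) X) :=
  fiberInclusion.map (b.chiApp (π_f₁ f) X).inv ≫ b.cart (π f) (b.pullObj (f₁ f) X)

instance compLift_isHomLift (X : p.Fiber B) : p.IsHomLift (π f) (b.compLift f X) := by
  unfold compLift; infer_instance

theorem compLift_fac (X : p.Fiber B) :
    b.compLift f X ≫ b.cart (f₁ f) X =
      b.cart (π₂ f) (b.pullObj (f₁ f) X) ≫ b.cart (f₁ f) X := by
  rw [compLift, Category.assoc, chiApp_inv_fac]

variable {f}

/-- For an arrow `u : f₁^* X ⟶ Y` over `f₂`, the induced arrow `π₂^* f₁^* X ⟶ f₁^* Y` over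
`π₁`. -/
def actLift {X Y : p.Fiber B}
    (u : fiberInclusion.obj (b.pullObj (f₁ f) X) ⟶ fiberInclusion.obj Y)
    (hu : p.IsHomLift (f₂ f) u) :
    fiberInclusion.obj (b.pullObj (π₂ f) (b.pullObj (f₁ f) X)) ⟶
      fiberInclusion.obj (b.pullObj (f₁ f) Y) :=
  b.cartLift (f₁ f) (π₁ f) (b.cart (π₂ f) (b.pullObj (f₁ f) X) ≫ u)
    (isHomLift_of_eq inferInstance (π₂_f₂ f))

instance actLift_isHomLift {X Y : p.Fiber B}
    (u : fiberInclusion.obj (b.pullObj (f₁ f) X) ⟶ fiberInclusion.obj Y)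
    (hu : p.IsHomLift (f₂ f) u) :
    p.IsHomLift (π₁ f) (b.actLift u hu) := by
  unfold actLift; infer_instance

theorem actLift_fac {X Y : p.Fiber B}
    (u : fiberInclusion.obj (b.pullObj (f₁ f) X) ⟶ fiberInclusion.obj Y)
    (hu : p.IsHomLift (f₂ f) u) :
    b.actLift u hu ≫ b.cart (f₁ f) Y = b.cart (π₂ f) (b.pullObj (f₁ f) X) ≫ u :=
  b.cartLift_fac _ _ _ _

/-- Each formalism builds its own arrow over `π₁` from `u`; this uniqueness identifies all of them.
-/
theorem eq_actLift {X Y : p.Fiber B}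
    {u : fiberInclusion.obj (b.pullObj (f₁ f) X) ⟶ fiberInclusion.obj Y}
    (hu : p.IsHomLift (f₂ f) u)
    {v : fiberInclusion.obj (b.pullObj (π₂ f) (b.pullObj (f₁ f) X)) ⟶
      fiberInclusion.obj (b.pullObj (f₁ f) Y)} (hv : p.IsHomLift (π₁ f) v)
    (h : v ≫ b.cart (f₁ f) Y = b.cart (π₂ f) (b.pullObj (f₁ f) X) ≫ u) : v = b.actLift u hu :=
  b.cart_ext (f₁ f) (π₁ f) hv inferInstance (h.trans (b.actLift_fac u hu).symm)

/-- An arrow `u : f₁^* X ⟶ X` over `f₂` is unital and associative for the internal category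
`Eq(f)`. Descent data, actions and algebra structures on `X` all amount to such arrows. -/
structure IsAction {X : p.Fiber B}
    (u : fiberInclusion.obj (b.pullObj (f₁ f) X) ⟶ fiberInclusion.obj X)
    (hu : p.IsHomLift (f₂ f) u) : Prop where
  unit : b.diagLift f X ≫ u = 𝟙 (fiberInclusion.obj X)
  assoc : b.actLift u hu ≫ u = b.compLift f X ≫ u

/-! ### Descent data as arrows over `f₂` -/

section Descent

variable {X : p.Fiber B} (φ : b.pullObj (f₁ f) X ⟶ b.pullObj (f₂ f) X)

/-- The arrow over `f₂` corresponding to `φ : f₁^* X ⟶ f₂^* X`. -/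
def arrowOfDesc : fiberInclusion.obj (b.pullObj (f₁ f) X) ⟶ fiberInclusion.obj X :=
  fiberInclusion.map φ ≫ b.cart (f₂ f) X

instance arrowOfDesc_isHomLift : p.IsHomLift (f₂ f) (b.arrowOfDesc φ) := by
  unfold arrowOfDesc; infer_instance

theorem dd1_iff :
    (b.d₁ f).hom.app X ≫ (b.pull (diag f)).map φ ≫ (b.d₂ f).inv.app X = 𝟙 X ↔
      b.diagLift f X ≫ b.arrowOfDesc φ = 𝟙 (fiberInclusion.obj X) := by
  change (b.d₁App f X).hom ≫ b.pullMap (diag f) φ ≫ (b.d₂App f X).inv = 𝟙 X ↔ _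
  rw [fiber_hom_ext_iff, Functor.map_comp, Functor.map_comp, d₂App_inv, reassoc_of% b.pullMap_fac,
    diagLift, arrowOfDesc, Category.assoc, CategoryTheory.Functor.map_id]

/-- Both sides of (DD2) end in `π₁^* f₂^* X`, so they may be compared after the cartesian lifts of
`π₁` and `f₂`. There the comparison isomorphisms disappear. -/
theorem dd2_iff :
    (b.pull (π₂ f)).map φ ≫ (b.j f).hom.app X ≫ (b.pull (π₁ f)).map φ =
        (b.j₁ f).inv.app X ≫ (b.pull (π f)).map φ ≫ (b.j₂ f).hom.app X ↔
      b.actLift (b.arrowOfDesc φ) inferInstance ≫ b.arrowOfDesc φ =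
        b.compLift f X ≫ b.arrowOfDesc φ := by
  change b.pullMap (π₂ f) φ ≫ (b.chiApp (π₂_f₂ f) X).hom ≫ b.pullMap (π₁ f) φ =
    (b.chiApp (π_f₁ f) X).inv ≫ b.pullMap (π f) φ ≫ (b.chiApp (π_f₂ f) X).hom ↔ _
  have hv : fiberInclusion.map (b.pullMap (π₂ f) φ) ≫
      fiberInclusion.map (b.chiApp (π₂_f₂ f) X).hom ≫ b.cart (π₁ f) (b.pullObj (f₁ f) X) =
        b.actLift (b.arrowOfDesc φ) inferInstance := by
    refine b.eq_actLift inferInstance inferInstance ?_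
    rw [Category.assoc, Category.assoc, chiApp_hom_fac, reassoc_of% b.pullMap_fac, arrowOfDesc]
  have hl : fiberInclusion.map (b.pullMap (π₂ f) φ ≫ (b.chiApp (π₂_f₂ f) X).hom ≫
      b.pullMap (π₁ f) φ) ≫ b.cart (π₁ f) (b.pullObj (f₂ f) X) ≫ b.cart (f₂ f) X =
        b.actLift (b.arrowOfDesc φ) inferInstance ≫ b.arrowOfDesc φ := by
    rw [← hv]
    simp only [Functor.map_comp, Category.assoc, arrowOfDesc, reassoc_of% b.pullMap_fac]
  have hr : fiberInclusion.map ((b.chiApp (π_f₁ f) X).inv ≫ b.pullMap (π f) φ ≫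
      (b.chiApp (π_f₂ f) X).hom) ≫ b.cart (π₁ f) (b.pullObj (f₂ f) X) ≫ b.cart (f₂ f) X =
        b.compLift f X ≫ b.arrowOfDesc φ := by
    simp only [Functor.map_comp, Category.assoc, arrowOfDesc, compLift, chiApp_hom_fac,
      reassoc_of% b.pullMap_fac]
  rw [← hl, ← hr]
  refine ⟨fun h => by rw [h], fun h => b.pull_hom_ext (π₁ f) ?_⟩
  refine b.cart_ext (f₂ f) (π₁ f) inferInstance inferInstance ?_
  simpa only [Category.assoc] using h

/-- The symmetry of the kernel pair of `f`. -/
def swap (f : B ⟶ A) : ker f ⟶ ker f :=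
  pullback.lift (f₂ f) (f₁ f) pullback.condition.symm

theorem swap_f₁ (f : B ⟶ A) : swap f ≫ f₁ f = f₂ f := pullback.lift_fst _ _ _

theorem swap_f₂ (f : B ⟶ A) : swap f ≫ f₂ f = f₁ f := pullback.lift_snd _ _ _

theorem swap_swap (f : B ⟶ A) : swap f ≫ swap f = 𝟙 (ker f) := by
  apply pullback.hom_ext
  · rw [Category.assoc, swap_f₁, swap_f₂, Category.id_comp]
  · rw [Category.assoc, swap_f₂, swap_f₁, Category.id_comp]

/-- The morphism `(x, y) ↦ ((x, y), (y, x))`. -/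
def withInverse (f : B ⟶ A) : ker f ⟶ ker₂ f :=
  pullback.lift (𝟙 (ker f)) (swap f) (by rw [swap_f₁, Category.id_comp])

theorem withInverse_π₂ (f : B ⟶ A) : withInverse f ≫ π₂ f = 𝟙 (ker f) := pullback.lift_fst _ _ _

theorem withInverse_π₁ (f : B ⟶ A) : withInverse f ≫ π₁ f = swap f := pullback.lift_snd _ _ _

/-- The groupoid law of `Eq(f)`: composing `(x, y)` with `(y, x)` gives `(x, x)`. -/
theorem withInverse_π (f : B ⟶ A) : withInverse f ≫ π f = f₁ f ≫ diag f := by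
  apply pullback.hom_ext
  · have := diag_f₁ f
    have h := π_f₁ f
    simp only [Category.assoc] at *
    rw [h, reassoc_of% withInverse_π₂ f, this, Category.comp_id]
  · have := diag_f₂ f
    have h := π_f₂ f
    simp only [Category.assoc] at *
    rw [h, reassoc_of% withInverse_π₁ f, this, Category.comp_id, swap_f₂]

variable {φ}

/-- A unital and associative arrow over `f₂` is invertible as a descent datum: its inverse is
obtained from the symmetry of the kernel pair. -/
theorem IsAction.isIso (h : b.IsAction (b.arrowOfDesc φ) inferInstance) : IsIso φ := by
  have i₂ : p.IsHomLift (swap f ≫ f₁ f) (b.cart (f₂ f) X) :=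
    isHomLift_of_eq inferInstance (swap_f₁ f).symm
  -- Reindexing along the symmetry: the candidate inverse `ψ` below is `u` evaluated at `(y, x)`.
  let s : fiberInclusion.obj (b.pullObj (f₂ f) X) ⟶ fiberInclusion.obj (b.pullObj (f₁ f) X) :=
    b.cartLift (f₁ f) (swap f) (b.cart (f₂ f) X) i₂
  have hs : s ≫ b.cart (f₁ f) X = b.cart (f₂ f) X := b.cartLift_fac _ _ _ _
  have is : p.IsHomLift (swap f) s := inferInstanceAs (p.IsHomLift _ (b.cartLift _ _ _ _))
  have i₁ : p.IsHomLift (f₁ f) (s ≫ b.arrowOfDesc φ) :=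
    isHomLift_of_eq inferInstance (swap_f₂ f)
  let ψ : b.pullObj (f₂ f) X ⟶ b.pullObj (f₁ f) X := b.pullLift (f₁ f) (s ≫ b.arrowOfDesc φ)
  have hψ : fiberInclusion.map ψ ≫ b.cart (f₁ f) X = s ≫ b.arrowOfDesc φ := b.pullLift_fac _ _
  have i₀ : p.IsHomLift (withInverse f ≫ π₂ f) (𝟙 (fiberInclusion.obj (b.pullObj (f₁ f) X))) :=
    isHomLift_of_eq (id_isHomLift _) (withInverse_π₂ f).symm
  -- Precomposing with `t` evaluates the associativity law at the pair `((x, y), (y, x))`.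
  let t := b.cartLift (π₂ f) (withInverse f) (𝟙 (fiberInclusion.obj (b.pullObj (f₁ f) X))) i₀
  have ht : t ≫ b.cart (π₂ f) (b.pullObj (f₁ f) X) = 𝟙 _ := b.cartLift_fac _ _ _ _
  have it : p.IsHomLift (withInverse f) t := inferInstanceAs (p.IsHomLift _ (b.cartLift _ _ _ _))
  have hn : t ≫ b.compLift f X = b.cart (f₁ f) X ≫ b.diagLift f X := by
    refine b.cart_ext (f₁ f) (withInverse f ≫ π f) inferInstance
      (isHomLift_of_eq inferInstance (withInverse_π f).symm) ?_
    rw [Category.assoc, Category.assoc, compLift_fac, reassoc_of% ht, diagLift_fac,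
      Category.comp_id]
  -- Associativity at this pair makes the double action equal to the action of `(x, x)`, which is
  -- trivial by unitality.
  have key : t ≫ b.actLift (b.arrowOfDesc φ) inferInstance ≫ b.arrowOfDesc φ =
      b.cart (f₁ f) X := by
    rw [h.assoc, reassoc_of% hn, h.unit, Category.comp_id]
  have iv : p.IsHomLift (swap f) (t ≫ b.actLift (b.arrowOfDesc φ) inferInstance) :=
    isHomLift_of_eq inferInstance (withInverse_π₁ f)
  -- Both sides lie over `swap f` and become `u` after the cartesian lift of `f₁`.
  have hv : fiberInclusion.map φ ≫ s = t ≫ b.actLift (b.arrowOfDesc φ) inferInstance := by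
    refine b.cart_ext (f₁ f) (swap f) inferInstance iv ?_
    rw [Category.assoc, Category.assoc, actLift_fac, reassoc_of% ht, hs, arrowOfDesc]
  have hv' : s ≫ t ≫ b.actLift (b.arrowOfDesc φ) inferInstance = fiberInclusion.map ψ := by
    refine b.cart_ext (f₁ f) (𝟙 (ker f)) (isHomLift_of_eq inferInstance (swap_swap f))
      inferInstance ?_
    rw [Category.assoc, Category.assoc, actLift_fac, reassoc_of% ht, hψ]
  refine ⟨ψ, b.pull_hom_ext (f₁ f) ?_, b.pull_hom_ext (f₂ f) ?_⟩
  · rw [Functor.map_comp, Category.assoc, hψ, reassoc_of% hv, key, CategoryTheory.Functor.map_id,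
      Category.id_comp]
  · rw [Functor.map_comp, Category.assoc, ← arrowOfDesc, ← hv', Category.assoc, Category.assoc, key,
      hs, CategoryTheory.Functor.map_id, Category.id_comp]

end Descent

/-! ### Actions of the kernel pair as arrows over `f₂` -/

section Act

variable {X : p.Fiber B} (β : b.pushObj (f₂ f) (b.pullObj (f₁ f) X) ⟶ X)

/-- The arrow over `f₂` corresponding to `β : (f₂)_! f₁^* X ⟶ X`. -/
def arrowOfAct : fiberInclusion.obj (b.pullObj (f₁ f) X) ⟶ fiberInclusion.obj X :=
  b.cocart (f₂ f) (b.pullObj (f₁ f) X) ≫ fiberInclusion.map β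

instance arrowOfAct_isHomLift : p.IsHomLift (f₂ f) (b.arrowOfAct β) := by
  unfold arrowOfAct; infer_instance

/-- The component of the unit `η'`. -/
def etaApp (f : B ⟶ A) (X : p.Fiber B) : X ⟶ b.pushObj (f₂ f) (b.pullObj (f₁ f) X) :=
  (b.d₁App f X).hom ≫ b.pullMap (diag f) (b.unitApp (f₂ f) (b.pullObj (f₁ f) X)) ≫
    (b.d₂App f (b.pushObj (f₂ f) (b.pullObj (f₁ f) X))).inv

theorem map_etaApp (X : p.Fiber B) :
    fiberInclusion.map (b.etaApp f X) =
      b.diagLift f X ≫ b.cocart (f₂ f) (b.pullObj (f₁ f) X) := by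
  rw [etaApp, Functor.map_comp, Functor.map_comp, d₂App_inv, reassoc_of% b.pullMap_fac, diagLift,
    Category.assoc, unitApp_fac]

theorem ac1_iff :
    b.eta' f X ≫ β = 𝟙 X ↔
      b.diagLift f X ≫ b.arrowOfAct β = 𝟙 (fiberInclusion.obj X) := by
  change b.etaApp f X ≫ β = 𝟙 X ↔ _
  rw [fiber_hom_ext_iff, Functor.map_comp, map_etaApp, arrowOfAct, Category.assoc,
    CategoryTheory.Functor.map_id]

/-- The component of `k₂`. -/
def k₂App (f : B ⟶ A) (Z : p.Fiber (ker₂ f)) :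
    b.pushObj (f₂ f) (b.pushObj (π₁ f) Z) ⟶ b.pushObj (f₂ f) (b.pushObj (π f) Z) :=
  (b.k₂ f).app Z

/-- The defining property of the mate relates the two composite units through `j₂`. Followed by
cartesian lifts, units become cocartesian lifts and `j₂` vanishes. -/
theorem k₂App_fac (Z : p.Fiber (ker₂ f)) :
    b.cocart (π₁ f) Z ≫ b.cocart (f₂ f) (b.pushObj (π₁ f) Z) ≫
        fiberInclusion.map (b.k₂App f Z) =
      b.cocart (π f) Z ≫ b.cocart (f₂ f) (b.pushObj (π f) Z) := by
  have h := unit_conjugateEquiv_symm ((b.adj (π f)).comp (b.adj (f₂ f)))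
    ((b.adj (π₁ f)).comp (b.adj (f₂ f))) (b.j₂ f).hom Z
  rw [Adjunction.comp_unit_app, Adjunction.comp_unit_app] at h
  replace h : (b.unitApp (π f) Z ≫ b.pullMap (π f) (b.unitApp (f₂ f) (b.pushObj (π f) Z))) ≫
      (b.chiApp (π_f₂ f) (b.pushObj (f₂ f) (b.pushObj (π f) Z))).hom =
    (b.unitApp (π₁ f) Z ≫ b.pullMap (π₁ f) (b.unitApp (f₂ f) (b.pushObj (π₁ f) Z))) ≫
      b.pullMap (π₁ f) (b.pullMap (f₂ f) (b.k₂App f Z)) := h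
  have h' := congrArg (fun s => fiberInclusion.map s ≫
    b.cart (π₁ f) (b.pullObj (f₂ f) (b.pushObj (f₂ f) (b.pushObj (π f) Z))) ≫
      b.cart (f₂ f) (b.pushObj (f₂ f) (b.pushObj (π f) Z))) h
  simp only [Functor.map_comp, Category.assoc, chiApp_hom_fac, reassoc_of% b.pullMap_fac,
    unitApp_fac, reassoc_of% b.unitApp_fac, pullMap_fac] at h'
  exact h'.symm

variable {b}

/-- The component of the inverse of the Beck-Chevalley transformation. -/
def bcInvApp (h : b.BeckChevalley) (f : B ⟶ A) (Y : p.Fiber (ker f)) :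
    b.pullObj (f₁ f) (b.pushObj (f₂ f) Y) ⟶ b.pushObj (π₁ f) (b.pullObj (π₂ f) Y) :=
  (bcInv h f).app Y

theorem bcArrow_bcInvApp (h : b.BeckChevalley) (f : B ⟶ A) (Y : p.Fiber (ker f)) :
    b.bcArrow (IsPullback.of_hasPullback (f₂ f) (f₁ f)).w Y ≫
      fiberInclusion.map (bcInvApp h f Y) = b.cocart (π₁ f) (b.pullObj (π₂ f) Y) := by
  have := h (IsPullback.of_hasPullback (f₂ f) (f₁ f))
  have e : b.bcApp (IsPullback.of_hasPullback (f₂ f) (f₁ f)).w Y ≫ bcInvApp h f Y = 𝟙 _ :=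
    NatTrans.congr_app (IsIso.hom_inv_id
      (b.beckChevalley (IsPullback.of_hasPullback (f₂ f) (f₁ f)).w)) Y
  rw [bcArrow, Category.assoc, ← Functor.map_comp, e, CategoryTheory.Functor.map_id,
    Category.comp_id]

/-- The component of the multiplication `μ'`. -/
def muApp (h : b.BeckChevalley) (f : B ⟶ A) (X : p.Fiber B) :
    b.pushObj (f₂ f) (b.pullObj (f₁ f) (b.pushObj (f₂ f) (b.pullObj (f₁ f) X))) ⟶
      b.pushObj (f₂ f) (b.pullObj (f₁ f) X) :=
  b.pushMap (f₂ f) (bcInvApp h f (b.pullObj (f₁ f) X)) ≫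
    b.pushMap (f₂ f) (b.pushMap (π₁ f) (b.chiApp (π_f₁ f) X).inv) ≫
    b.k₂App f (b.pullObj (π f) (b.pullObj (f₁ f) X)) ≫
    b.pushMap (f₂ f) (b.counitApp (π f) (b.pullObj (f₁ f) X))

/-- The factors of `μ'` cancel one by one against the lifts, leaving reindexing along the
composition `π`. -/
theorem muApp_fac (h : b.BeckChevalley) (f : B ⟶ A) (X : p.Fiber B) :
    b.bcArrow (IsPullback.of_hasPullback (f₂ f) (f₁ f)).w (b.pullObj (f₁ f) X) ≫
      b.cocart (f₂ f) (b.pullObj (f₁ f) (b.pushObj (f₂ f) (b.pullObj (f₁ f) X))) ≫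
        fiberInclusion.map (muApp h f X) =
      b.compLift f X ≫ b.cocart (f₂ f) (b.pullObj (f₁ f) X) := by
  rw [muApp, Functor.map_comp, Functor.map_comp, Functor.map_comp, reassoc_of% b.pushMap_fac,
    reassoc_of% b.pushMap_fac, reassoc_of% bcArrow_bcInvApp h f (b.pullObj (f₁ f) X),
    reassoc_of% b.pushMap_fac, reassoc_of% b.k₂App_fac, pushMap_fac, reassoc_of% b.counitApp_fac,
    compLift, Category.assoc]

/-- Both sides are tested on a cocartesian lift of `f₂` preceded by `bcArrow` of the square `f₂ π₂ =
f₁ π₁`; Beck-Chevalley makes this test faithful. -/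
theorem ac2_iff (h : b.BeckChevalley) :
    mu' h f X ≫ β = (b.push (f₂ f)).map ((b.pull (f₁ f)).map β) ≫ β ↔
      b.actLift (b.arrowOfAct β) inferInstance ≫ b.arrowOfAct β =
        b.compLift f X ≫ b.arrowOfAct β := by
  change muApp h f X ≫ β = b.pushMap (f₂ f) (b.pullMap (f₁ f) β) ≫ β ↔ _
  have sq := IsPullback.of_hasPullback (f₂ f) (f₁ f)
  have hv : b.bcArrow sq.w (b.pullObj (f₁ f) X) ≫ fiberInclusion.map (b.pullMap (f₁ f) β) =
      b.actLift (b.arrowOfAct β) inferInstance := by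
    refine b.eq_actLift inferInstance inferInstance ?_
    rw [Category.assoc, pullMap_fac, reassoc_of% b.bcArrow_fac, arrowOfAct]
  have hl : b.bcArrow sq.w (b.pullObj (f₁ f) X) ≫ b.cocart (f₂ f) _ ≫
      fiberInclusion.map (b.pushMap (f₂ f) (b.pullMap (f₁ f) β) ≫ β) =
        b.actLift (b.arrowOfAct β) inferInstance ≫ b.arrowOfAct β := by
    rw [← hv, Functor.map_comp, reassoc_of% b.pushMap_fac, Category.assoc, arrowOfAct]
  have hr : b.bcArrow sq.w (b.pullObj (f₁ f) X) ≫ b.cocart (f₂ f) _ ≫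
      fiberInclusion.map (muApp h f X ≫ β) = b.compLift f X ≫ b.arrowOfAct β := by
    rw [Functor.map_comp, reassoc_of% muApp_fac h f X, arrowOfAct]
  rw [← hl, ← hr]
  refine ⟨fun e => by rw [e], fun e => b.push_hom_ext (f₂ f) ?_⟩
  exact (bcArrow_ext h sq (f₂ f) inferInstance inferInstance e).symm

end Act

/-! ### Algebras of the monad as arrows over `f₂` -/

section EM

variable {X : p.Fiber B} (α : b.pullObj f (b.pushObj f X) ⟶ X)

/-- The arrow over `f₂` corresponding to `α : f^* f_! X ⟶ X`. -/
def arrowOfAlg : fiberInclusion.obj (b.pullObj (f₁ f) X) ⟶ fiberInclusion.obj X :=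
  b.bcArrow (pullback.condition (f := f) (g := f)) X ≫ fiberInclusion.map α

instance arrowOfAlg_isHomLift : p.IsHomLift (f₂ f) (b.arrowOfAlg α) := by
  unfold arrowOfAlg; infer_instance

/-- Both sides lie over `𝟙 B`, and the cartesian lift of `f` takes each to the cocartesian lift of
`f` at `X`. -/
theorem diagLift_bcArrow (X : p.Fiber B) :
    b.diagLift f X ≫ b.bcArrow (pullback.condition (f := f) (g := f)) X =
      fiberInclusion.map (b.unitApp f X) := by
  refine b.cart_ext f (𝟙 B) (isHomLift_of_eq inferInstance (diag_f₂ f)) inferInstance ?_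
  rw [Category.assoc, bcArrow_fac, unitApp_fac, ← Category.assoc, diagLift_fac, Category.id_comp]

theorem alg_unit_iff :
    b.unitApp f X ≫ α = 𝟙 X ↔
      b.diagLift f X ≫ b.arrowOfAlg α = 𝟙 (fiberInclusion.obj X) := by
  rw [fiber_hom_ext_iff, Functor.map_comp, ← diagLift_bcArrow, arrowOfAlg, Category.assoc,
    CategoryTheory.Functor.map_id]

variable {b}

/-- The domain `f^* f_! f^* f_! X` is reached from `π₂^* f₁^* X` by applying Beck-Chevalley
repeatedly, for the square of `π₁`, `π₂` and for the kernel pair. The resulting arrow can be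
cancelled, and it carries the multiplication to composition in `Eq(f)`. -/
theorem alg_assoc_iff (h : b.BeckChevalley) :
    b.pullMap f (b.counitApp f (b.pushObj f X)) ≫ α = b.pullMap f (b.pushMap f α) ≫ α ↔
      b.actLift (b.arrowOfAlg α) inferInstance ≫ b.arrowOfAlg α =
        b.compLift f X ≫ b.arrowOfAlg α := by
  have sq := IsPullback.of_hasPullback (f₂ f) (f₁ f)
  have sq' := IsPullback.of_hasPullback f f
  let c (Y : p.Fiber B) := b.bcArrow (pullback.condition (f := f) (g := f)) Y
  let v := b.bcArrow sq.w (b.pullObj (f₁ f) X) ≫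
    fiberInclusion.map (b.pullMap (f₁ f) (b.bcApp sq'.w X))
  have hv : v ≫ b.cart (f₁ f) (b.pullObj f (b.pushObj f X)) =
      b.cart (π₂ f) (b.pullObj (f₁ f) X) ≫ c X := by
    simp only [v, c]
    rw [Category.assoc, pullMap_fac, reassoc_of% b.bcArrow_fac]
    rfl
  have hva : v ≫ fiberInclusion.map (b.pullMap (f₁ f) α) =
      b.actLift (b.arrowOfAlg α) inferInstance := by
    refine b.eq_actLift inferInstance inferInstance ?_
    rw [Category.assoc, pullMap_fac, reassoc_of% hv, arrowOfAlg]
  have hl : v ≫ c (b.pullObj f (b.pushObj f X)) ≫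
      fiberInclusion.map (b.pullMap f (b.pushMap f α) ≫ α) =
        b.actLift (b.arrowOfAlg α) inferInstance ≫ b.arrowOfAlg α := by
    rw [← hva, Functor.map_comp, ← reassoc_of% b.bcArrow_naturality, arrowOfAlg]
    simp only [v, Category.assoc]
  have hμ : v ≫ c (b.pullObj f (b.pushObj f X)) ≫
      fiberInclusion.map (b.pullMap f (b.counitApp f (b.pushObj f X))) =
        b.compLift f X ≫ c X := by
    -- The two sides lie over `π₁ f ≫ f₂ f` and `π f ≫ f₂ f`, which agree; the cartesian lift of `f`
    -- then cancels the counit.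
    refine b.cart_ext f (π₁ f ≫ f₂ f) inferInstance
      (isHomLift_of_eq inferInstance (π_f₂ f)) ?_
    simp only [Category.assoc, pullMap_fac, c]
    rw [reassoc_of% b.bcArrow_fac, counitApp_fac, bcArrow_fac, reassoc_of% hv, bcArrow_fac,
      reassoc_of% b.compLift_fac]
  have hr : v ≫ c (b.pullObj f (b.pushObj f X)) ≫
      fiberInclusion.map (b.pullMap f (b.counitApp f (b.pushObj f X)) ≫ α) =
        b.compLift f X ≫ b.arrowOfAlg α := by
    rw [Functor.map_comp, reassoc_of% hμ, arrowOfAlg]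
  rw [← hl, ← hr]
  refine ⟨fun e => by rw [e], fun e => Functor.Fiber.hom_ext ?_⟩
  -- The test arrow is cancelled from its last factor to its first: kernel pair, pulled-back
  -- isomorphism, then the square of `π₁` and `π₂`.
  refine (bcArrow_ext h sq' (𝟙 B) inferInstance inferInstance ?_).symm
  have := bcApp_isIso h sq' X
  have : IsIso (b.pullMap (f₁ f) (b.bcApp sq'.w X)) :=
    inferInstanceAs (IsIso ((b.pull (f₁ f)).map (b.bcApp sq'.w X)))
  rw [← cancel_epi (fiberInclusion.map (b.pullMap (f₁ f) (b.bcApp sq'.w X)))]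
  refine bcArrow_ext h sq (f₂ f) inferInstance inferInstance ?_
  simpa only [v, Category.assoc] using e

end EM

end

noncomputable section

/-- Functors into a category with a faithful functor `U` are equal when they agree on objects and
after composition with `U`. -/
theorem functor_ext_of_faithful {D K L : Type*} [Category D] [Category K] [Category L] (U : K ⥤ L)
    [U.Faithful] {F G : D ⥤ K} (hobj : ∀ X, F.obj X = G.obj X) (hU : F ⋙ U = G ⋙ U) : F = G :=
  CategoryTheory.Functor.ext hobj fun X Y t => U.map_injective (by
    simpa [eqToHom_map] using Functor.congr_hom hU t)

/-- Both carriers are compared with a third object because values of composite functors have the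
right carrier only up to unfolding. -/
theorem algebra_eq_of_a_eq {K : Type*} [Category K] {T : Monad K} {X : K} {M N : T.Algebra}
    (hM : M.A = X) (hN : N.A = X)
    (h : HEq M.a N.a) : M = N := by
  cases M; cases N
  cases hM; cases hN; cases h; rfl

/-- Strictlyy inverse functors form an equivalence. -/
def equivalenceOfEq {K L : Type*} [Category K] [Category L] (F : K ⥤ L) (G : L ⥤ K)
    (h : F ⋙ G = 𝟭 K) (h' : G ⋙ F = 𝟭 L) : K ≌ L :=
  CategoryTheory.Equivalence.mk F G (eqToIso h.symm) (eqToIso h')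

variable {C : Type u₁} [Category.{v₁} C] [HasPullbacks C] {E : Type u₂} [Category.{v₂} E]
  {p : E ⥤ C} {b : ClovenBifibration p} {A B : C} {f : B ⟶ A}

/-! ### Recovering each structure, and its morphisms, from the arrow over `f₂` -/

section Arrows

variable {X : p.Fiber B}

variable (b) in
/-- The morphism `f₁^* X ⟶ f₂^* X` corresponding to an arrow over `f₂`. -/
def descOfArrow (u : fiberInclusion.obj (b.pullObj (f₁ f) X) ⟶ fiberInclusion.obj X)
    [p.IsHomLift (f₂ f) u] : b.pullObj (f₁ f) X ⟶ b.pullObj (f₂ f) X :=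
  b.pullLift (f₂ f) u

theorem arrowOfDesc_descOfArrow
    (u : fiberInclusion.obj (b.pullObj (f₁ f) X) ⟶ fiberInclusion.obj X) [p.IsHomLift (f₂ f) u] :
    b.arrowOfDesc (b.descOfArrow u) = u :=
  b.pullLift_fac (f₂ f) u

theorem arrowOfDesc_injective :
    Function.Injective (b.arrowOfDesc (f := f) (X := X)) := fun _ _ h => b.pull_hom_ext (f₂ f) h

variable (b) in
/-- The morphism `(f₂)_! f₁^* X ⟶ X` corresponding to an arrow over `f₂`. -/
def actOfArrow (u : fiberInclusion.obj (b.pullObj (f₁ f) X) ⟶ fiberInclusion.obj X)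
    [p.IsHomLift (f₂ f) u] : b.pushObj (f₂ f) (b.pullObj (f₁ f) X) ⟶ X :=
  b.pushDesc (f₂ f) u

theorem arrowOfAct_actOfArrow
    (u : fiberInclusion.obj (b.pullObj (f₁ f) X) ⟶ fiberInclusion.obj X) [p.IsHomLift (f₂ f) u] :
    b.arrowOfAct (b.actOfArrow u) = u :=
  b.pushDesc_fac (f₂ f) u

theorem arrowOfAct_injective :
    Function.Injective (b.arrowOfAct (f := f) (X := X)) := fun _ _ h => b.push_hom_ext (f₂ f) h

/-- The morphism `f^* f_! X ⟶ X` corresponding to a morphism `(f₂)_! f₁^* X ⟶ X` under the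
Beck-Chevalley isomorphism of the kernel pair. -/
def algOfAct (h : b.BeckChevalley) (β : b.pushObj (f₂ f) (b.pullObj (f₁ f) X) ⟶ X) :
    b.pullObj f (b.pushObj f X) ⟶ X :=
  have := bcApp_isIso h (IsPullback.of_hasPullback f f) X
  inv (b.bcApp (IsPullback.of_hasPullback f f).w X) ≫ β

theorem arrowOfAlg_algOfAct (h : b.BeckChevalley)
    (β : b.pushObj (f₂ f) (b.pullObj (f₁ f) X) ⟶ X) :
    b.arrowOfAlg (algOfAct h β) = b.arrowOfAct β := by
  have := bcApp_isIso h (IsPullback.of_hasPullback f f) X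
  rw [arrowOfAlg, arrowOfAct, bcArrow, algOfAct, Category.assoc, ← Functor.map_comp,
    IsIso.hom_inv_id_assoc]

theorem arrowOfAlg_injective (h : b.BeckChevalley) :
    Function.Injective (b.arrowOfAlg (f := f) (X := X)) := fun _ _ e =>
  Functor.Fiber.hom_ext (bcArrow_ext h (IsPullback.of_hasPullback f f) (𝟙 B) inferInstance
    inferInstance e)

/-- Encoding and decoding return `u` only up to propositional equality, so the axioms must be
transported together with the lifting proof. -/
theorem IsAction.congr {u u' : fiberInclusion.obj (b.pullObj (f₁ f) X) ⟶ fiberInclusion.obj X}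
    {hu : p.IsHomLift (f₂ f) u} (h : b.IsAction u hu) (e : u' = u) (hu' : p.IsHomLift (f₂ f) u') :
    b.IsAction u' hu' := by
  subst e; exact h

variable {Y : p.Fiber B} (θ : X ⟶ Y)

/-- With its two analogues below, this gives the three kinds of morphism the same description:
arrows intertwining the actions `u`. -/
theorem desc_comm_iff (φ : b.pullObj (f₁ f) X ⟶ b.pullObj (f₂ f) X)
    (ψ : b.pullObj (f₁ f) Y ⟶ b.pullObj (f₂ f) Y) :
    φ ≫ (b.pull (f₂ f)).map θ = (b.pull (f₁ f)).map θ ≫ ψ ↔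
      b.arrowOfDesc φ ≫ fiberInclusion.map θ =
        fiberInclusion.map (b.pullMap (f₁ f) θ) ≫ b.arrowOfDesc ψ := by
  change φ ≫ b.pullMap (f₂ f) θ = b.pullMap (f₁ f) θ ≫ ψ ↔ _
  have hl : fiberInclusion.map (φ ≫ b.pullMap (f₂ f) θ) ≫ b.cart (f₂ f) Y =
      b.arrowOfDesc φ ≫ fiberInclusion.map θ := by
    rw [Functor.map_comp, Category.assoc, pullMap_fac, arrowOfDesc, Category.assoc]
  have hr : fiberInclusion.map (b.pullMap (f₁ f) θ ≫ ψ) ≫ b.cart (f₂ f) Y =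
      fiberInclusion.map (b.pullMap (f₁ f) θ) ≫ b.arrowOfDesc ψ := by
    rw [Functor.map_comp, Category.assoc, arrowOfDesc]
  rw [← hl, ← hr]
  exact ⟨fun e => by rw [e], fun e => b.pull_hom_ext (f₂ f) e⟩

theorem act_comm_iff (β : b.pushObj (f₂ f) (b.pullObj (f₁ f) X) ⟶ X)
    (γ : b.pushObj (f₂ f) (b.pullObj (f₁ f) Y) ⟶ Y) :
    β ≫ θ = (b.push (f₂ f)).map ((b.pull (f₁ f)).map θ) ≫ γ ↔
      b.arrowOfAct β ≫ fiberInclusion.map θ =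
        fiberInclusion.map (b.pullMap (f₁ f) θ) ≫ b.arrowOfAct γ := by
  change β ≫ θ = b.pushMap (f₂ f) (b.pullMap (f₁ f) θ) ≫ γ ↔ _
  have hl : b.cocart (f₂ f) _ ≫ fiberInclusion.map (β ≫ θ) =
      b.arrowOfAct β ≫ fiberInclusion.map θ := by
    rw [Functor.map_comp, arrowOfAct, Category.assoc]
  have hr : b.cocart (f₂ f) _ ≫ fiberInclusion.map (b.pushMap (f₂ f) (b.pullMap (f₁ f) θ) ≫ γ) =
      fiberInclusion.map (b.pullMap (f₁ f) θ) ≫ b.arrowOfAct γ := by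
    rw [Functor.map_comp, reassoc_of% b.pushMap_fac, arrowOfAct]
  rw [← hl, ← hr]
  exact ⟨fun e => by rw [e], fun e => b.push_hom_ext (f₂ f) e⟩

theorem alg_comm_iff (h : b.BeckChevalley) (α : b.pullObj f (b.pushObj f X) ⟶ X)
    (γ : b.pullObj f (b.pushObj f Y) ⟶ Y) :
    b.pullMap f (b.pushMap f θ) ≫ γ = α ≫ θ ↔
      b.arrowOfAlg α ≫ fiberInclusion.map θ =
        fiberInclusion.map (b.pullMap (f₁ f) θ) ≫ b.arrowOfAlg γ := by
  have hl : b.bcArrow (pullback.condition (f := f) (g := f)) X ≫ fiberInclusion.map (α ≫ θ) =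
      b.arrowOfAlg α ≫ fiberInclusion.map θ := by
    rw [Functor.map_comp, arrowOfAlg, Category.assoc]
  have hr : b.bcArrow (pullback.condition (f := f) (g := f)) X ≫
      fiberInclusion.map (b.pullMap f (b.pushMap f θ) ≫ γ) =
        fiberInclusion.map (b.pullMap (f₁ f) θ) ≫ b.arrowOfAlg γ := by
    rw [Functor.map_comp, ← reassoc_of% b.bcArrow_naturality, arrowOfAlg]
  rw [← hl, ← hr]
  exact ⟨fun e => by rw [e], fun e => Functor.Fiber.hom_ext
    (bcArrow_ext h (IsPullback.of_hasPullback f f) (𝟙 B) inferInstance inferInstance e.symm)⟩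

end Arrows

/-! ### The three functors and their cyclic composites -/

/-- The structure map of a `T_f`-algebra. -/
def algStr (M : b.EM f) : b.pullObj f (b.pushObj f M.A) ⟶ M.A := M.a

/-- The morphism `f₁^* X ⟶ f₂^* X` of a descent datum. -/
def descStr (M : b.Desc f) : b.pullObj (f₁ f) M.X ⟶ b.pullObj (f₂ f) M.X := M.φ

/-- The morphism `(f₂)_! f₁^* X ⟶ X` of an action. -/
def actStr {h : b.BeckChevalley} (M : Act h f) :
    b.pushObj (f₂ f) (b.pullObj (f₁ f) M.X) ⟶ M.X := M.β

theorem isAction_of_alg (h : b.BeckChevalley) (M : b.EM f) :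
    b.IsAction (b.arrowOfAlg (algStr M)) inferInstance where
  unit := (b.alg_unit_iff (algStr M)).1 M.unit
  assoc := (alg_assoc_iff (algStr M) h).1 M.assoc

theorem isAction_of_desc (M : b.Desc f) : b.IsAction (b.arrowOfDesc (descStr M)) inferInstance where
  unit := (b.dd1_iff (descStr M)).1 M.dd1
  assoc := (b.dd2_iff (descStr M)).1 M.dd2

theorem isAction_of_act {h : b.BeckChevalley} (M : Act h f) :
    b.IsAction (b.arrowOfAct (actStr M)) inferInstance where
  unit := (b.ac1_iff (actStr M)).1 M.ac1
  assoc := (ac2_iff (actStr M) h).1 M.ac2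

/-- The descent datum on `X` corresponding to a unital and associative arrow over `f₂`. -/
def Desc.ofIsAction {X : p.Fiber B}
    {u : fiberInclusion.obj (b.pullObj (f₁ f) X) ⟶ fiberInclusion.obj X}
    {hu : p.IsHomLift (f₂ f) u} (h : b.IsAction u hu) : b.Desc f :=
  have h' := h.congr (arrowOfDesc_descOfArrow u) inferInstance
  { X := X
    φ := b.descOfArrow u
    isIso := h'.isIso
    dd1 := (b.dd1_iff _).2 h'.unit
    dd2 := (b.dd2_iff _).2 h'.assoc }

/-- The action on `X` corresponding to a unital and associative arrow over `f₂`. -/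
def Act.ofIsAction (hb : b.BeckChevalley) {X : p.Fiber B}
    {u : fiberInclusion.obj (b.pullObj (f₁ f) X) ⟶ fiberInclusion.obj X}
    {hu : p.IsHomLift (f₂ f) u} (h : b.IsAction u hu) : Act hb f :=
  have h' := h.congr (arrowOfAct_actOfArrow u) inferInstance
  { X := X
    β := b.actOfArrow u
    ac1 := (b.ac1_iff _).2 h'.unit
    ac2 := (ac2_iff _ hb).2 h'.assoc }

/-- The `T_f`-algebra structure on `X` corresponding to an action. -/
def algOfIsAction (hb : b.BeckChevalley) {X : p.Fiber B}
    {β : b.pushObj (f₂ f) (b.pullObj (f₁ f) X) ⟶ X}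
    (h : b.IsAction (b.arrowOfAct β) inferInstance) : b.EM f :=
  have h' := h.congr (arrowOfAlg_algOfAct hb β) inferInstance
  { A := X
    a := algOfAct hb β
    unit := (b.alg_unit_iff _).2 h'.unit
    assoc := (alg_assoc_iff _ hb).2 h'.assoc }

/-- The functor from `T_f`-algebras to descent data. -/
def emToDesc (h : b.BeckChevalley) (f : B ⟶ A) : b.EM f ⥤ b.Desc f where
  obj M := Desc.ofIsAction (isAction_of_alg h M)
  map {M N} s :=
    { θ := s.f
      comm := (desc_comm_iff s.f (b.descOfArrow (b.arrowOfAlg (algStr M)))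
        (b.descOfArrow (b.arrowOfAlg (algStr N)))).2 (by
        have e := (alg_comm_iff s.f h (algStr M) (algStr N)).1 s.h
        rwa [arrowOfDesc_descOfArrow, arrowOfDesc_descOfArrow]) }
  map_id _ := rfl
  map_comp _ _ := rfl

/-- The functor from descent data to actions. -/
def descToAct (h : b.BeckChevalley) (f : B ⟶ A) : b.Desc f ⥤ Act h f where
  obj M := Act.ofIsAction h (isAction_of_desc M)
  map {M N} s :=
    { θ := s.θ
      comm := (act_comm_iff s.θ (b.actOfArrow (b.arrowOfDesc (descStr M)))
        (b.actOfArrow (b.arrowOfDesc (descStr N)))).2 (by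
        have e := (desc_comm_iff s.θ (descStr M) (descStr N)).1 s.comm
        rwa [arrowOfAct_actOfArrow, arrowOfAct_actOfArrow]) }
  map_id _ := rfl
  map_comp _ _ := rfl

/-- The functor from actions to `T_f`-algebras. -/
def actToEM (h : b.BeckChevalley) (f : B ⟶ A) : Act h f ⥤ b.EM f where
  obj M := algOfIsAction h (isAction_of_act M)
  map {M N} s :=
    { f := s.θ
      h := (alg_comm_iff s.θ h (algOfAct h (actStr M)) (algOfAct h (actStr N))).2 (by
        have e := (act_comm_iff s.θ (actStr M) (actStr N)).1 s.comm
        rwa [arrowOfAlg_algOfAct, arrowOfAlg_algOfAct]) }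
  map_id _ := rfl
  map_comp _ _ := rfl

instance : (Desc.forget b f).Faithful where
  map_injective e := Desc.Hom.ext e

instance (h : b.BeckChevalley) : (Act.forget f h).Faithful where
  map_injective e := Act.Hom.ext e

theorem Desc.eq_of_φ_eq {X : p.Fiber B} {M N : b.Desc f} (hM : M.X = X) (hN : N.X = X)
    (h : HEq M.φ N.φ) : M = N := by
  cases M; cases N
  cases hM; cases hN; cases h; rfl

theorem Act.eq_of_β_eq {h : b.BeckChevalley} {X : p.Fiber B} {M N : Act h f} (hM : M.X = X)
    (hN : N.X = X) (e : HEq M.β N.β) : M = N := by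
  cases M; cases N
  cases hM; cases hN; cases e; rfl

/-- Each functor preserves the arrow over `f₂`, so a full cycle returns a structure with the same
arrow, hence the same structure. The other two cycles follow the same pattern. -/
theorem emToDesc_descToAct_actToEM (h : b.BeckChevalley) (f : B ⟶ A) :
    emToDesc h f ⋙ descToAct h f ⋙ actToEM h f = 𝟭 (b.EM f) := by
  refine functor_ext_of_faithful (b.T f).forget (fun M => ?_) rfl
  refine algebra_eq_of_a_eq (X := M.A) rfl rfl (heq_of_eq ?_)
  change algOfAct h (b.actOfArrow (b.arrowOfDesc (b.descOfArrow (b.arrowOfAlg (algStr M))))) =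
    algStr M
  apply arrowOfAlg_injective h
  rw [arrowOfAlg_algOfAct, arrowOfAct_actOfArrow, arrowOfDesc_descOfArrow]

theorem descToAct_actToEM_emToDesc (h : b.BeckChevalley) (f : B ⟶ A) :
    descToAct h f ⋙ actToEM h f ⋙ emToDesc h f = 𝟭 (b.Desc f) := by
  refine functor_ext_of_faithful (Desc.forget b f) (fun M => ?_) rfl
  refine Desc.eq_of_φ_eq (X := M.X) rfl rfl (heq_of_eq ?_)
  change b.descOfArrow (b.arrowOfAlg (algOfAct h (b.actOfArrow (b.arrowOfDesc (descStr M))))) =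
    descStr M
  apply arrowOfDesc_injective
  rw [arrowOfDesc_descOfArrow, arrowOfAlg_algOfAct, arrowOfAct_actOfArrow]

theorem actToEM_emToDesc_descToAct (h : b.BeckChevalley) (f : B ⟶ A) :
    actToEM h f ⋙ emToDesc h f ⋙ descToAct h f = 𝟭 (Act h f) := by
  refine functor_ext_of_faithful (Act.forget f h) (fun M => ?_) rfl
  refine Act.eq_of_β_eq (X := M.X) rfl rfl (heq_of_eq ?_)
  change b.actOfArrow (b.arrowOfDesc (b.descOfArrow (b.arrowOfAlg (algOfAct h (actStr M))))) =
    actStr M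
  apply arrowOfAct_injective
  rw [arrowOfAct_actOfArrow, arrowOfDesc_descOfArrow, arrowOfAlg_algOfAct]

end

end ClovenBifibration

theorem theorem2 {C : Type u₁} [Category.{v₁} C] [HasPullbacks C] {E : Type u₂} [Category.{v₂} E]
    {p : E ⥤ C} (b : ClovenBifibration p) (h : b.BeckChevalley) {A B : C} (f : B ⟶ A) :
    ∃ (F : b.EM f ≌ b.Desc f) (G : b.Desc f ≌ ClovenBifibration.Act h f)
      (H : ClovenBifibration.Act h f ≌ b.EM f),
      (F.functor ⋙ G.functor ⋙ H.functor = 𝟭 (b.EM f) ∧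
        G.functor ⋙ H.functor ⋙ F.functor = 𝟭 (b.Desc f) ∧
        H.functor ⋙ F.functor ⋙ G.functor = 𝟭 (ClovenBifibration.Act h f)) ∧
      (F.functor ⋙ ClovenBifibration.Desc.forget b f = (b.T f).forget ∧
        G.functor ⋙ ClovenBifibration.Act.forget f h = ClovenBifibration.Desc.forget b f ∧
        H.functor ⋙ (b.T f).forget = ClovenBifibration.Act.forget f h) := by
  have e₁ := ClovenBifibration.emToDesc_descToAct_actToEM h f
  have e₂ := ClovenBifibration.descToAct_actToEM_emToDesc h f
  have e₃ := ClovenBifibration.actToEM_emToDesc_descToAct h f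
  -- The inverse of each functor is the composite of the other two, so two of the cyclic identities
  -- suffice for each equivalence.
  exact ⟨ClovenBifibration.equivalenceOfEq _ _ e₁ e₂, ClovenBifibration.equivalenceOfEq _ _ e₂ e₃,
    ClovenBifibration.equivalenceOfEq _ _ e₃ e₁, ⟨e₁, e₂, e₃⟩, rfl, rfl, rfl⟩
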